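/- Let $\nabla$ be a smooth linear connection on (the tangent bundle of) $\mathbb{R}^n$, not necessarily torsion free. Its holonomy group at $x\in\mathbb{R}^n$ is the group of all parallel transports along piecewise smooth loops based at $x$, acting on $T_x\mathbb{R}^n$; it is irreducible if it leaves no proper non-trivial linear subspace of $T_x\mathbb{R}^n$ invariant. A semi-Riemannian metric is a smooth field of nondegenerate symmetric bilinear forms on the tangent spaces, and it is parallel if $\nabla g=0$. Metrics are called independent if they are linearly independent at every point (for parallel metrics on $\mathbb{R}^n$ this is equivalent to linear independence over $\mathbb{R}$ as tensor fields). (i) Let $n=2m$ with $m\ge 3$. There exist two independent semi-Riemannian metrics on $\mathbb{R}^n$, both of signature $(m,m)$, and a smooth linear connection on $\mathbb{R}^n$ with respect to which both metrics are parallel and which has irreducible holonomy group. (ii) Let $n=2m$ and $m=2r$ with $r\ge 2$. There exist three independent semi-Riemannian metrics on $\mathbb{R}^n$, all of signature $(m,m)$, and a smooth linear connection on $\mathbb{R}^n$ with respect to which all three metrics are parallel and which has irreducible holonomy group. -/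

import Mathlib

open scoped Manifold ContDiff

noncomputable section

namespace Holonomy

variable {E : Type*} [NormedAddCommGroup E] [NormedSpace ℝ E]

/-- A covariant derivative on the tangent bundle of the manifold `E`
(not assumed to be torsion free). -/
abbrev LinearConnection (E : Type*) [NormedAddCommGroup E] [NormedSpace ℝ E] :=
  CovariantDerivative 𝓘(ℝ, E) E (fun x : E => TangentSpace 𝓘(ℝ, E) x)

/-- The covariant derivative of a vector field `Y`: `cov.nabla Y x u` is `∇_u Y` at the point `x`,
with all tangent spaces of `E` identified with `E`. -/
def LinearConnection.nabla (cov : LinearConnection E) (Y : E → E) (x : E) : E →L[ℝ] E :=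
  cov Y x

/-- A smooth linear connection: the tensor field `∇Y` is smooth for every smooth vector field `Y`
(equivalently, its Christoffel symbols are smooth). -/
def LinearConnection.IsSmooth (cov : LinearConnection E) : Prop :=
  ∀ Y : E → E, ContDiff ℝ ∞ Y → ContDiff ℝ ∞ (cov.nabla Y)

variable (E) in
/-- A semi-Riemannian metric on `E`: a smooth field of nondegenerate symmetric bilinear forms. -/
structure SemiRiemannianMetric where
  form : E → E →L[ℝ] E →L[ℝ] ℝ
  smooth : ContDiff ℝ ∞ form
  symm : ∀ x v w, form x v w = form x w v
  nondegenerate : ∀ x v, (∀ w, form x v w = 0) → v = 0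

/-- The quadratic form `v ↦ g_x(v, v)`. -/
def SemiRiemannianMetric.quadraticForm (g : SemiRiemannianMetric E) (x : E) :
    QuadraticForm ℝ E :=
  LinearMap.BilinMap.toQuadraticMap (g.form x).toBilinForm

/-- The metric `g` has signature `(p, q)` at every point. -/
def SemiRiemannianMetric.HasSignature (g : SemiRiemannianMetric E) (p q : ℕ) : Prop :=
  ∀ x, sigPos (g.quadraticForm x) = p ∧ sigNeg (g.quadraticForm x) = q

/-- Linear independence of the metrics at every point (hence also as tensor fields,
over the real numbers). -/
def SemiRiemannianMetric.Independent {ι : Type*} (g : ι → SemiRiemannianMetric E) : Prop :=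
  ∀ x, LinearIndependent ℝ (fun i => (g i).form x)

/-- `∇ g = 0`, that is, `u (g(Y, Z)) = g(∇_u Y, Z) + g(Y, ∇_u Z)` for all smooth vector
fields `Y`, `Z` and all tangent vectors `u`. -/
def SemiRiemannianMetric.IsParallel (g : SemiRiemannianMetric E)
    (cov : LinearConnection E) : Prop :=
  ∀ Y Z : E → E, ContDiff ℝ ∞ Y → ContDiff ℝ ∞ Z → ∀ x u : E,
    fderiv ℝ (fun y => g.form y (Y y) (Z y)) x u =
      g.form x (cov.nabla Y x u) (Z x) + g.form x (Y x) (cov.nabla Z x u)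

namespace LinearConnection

/-- The vector field `V` along the curve `γ : [0, 1] → E` is parallel. In the global frame of
constant vector fields `∂_j`, its covariant derivative along `γ` is
`V' + ∑ j, V^j ∇_{γ'} ∂_j`, and the sum is the covariant derivative in direction `γ'(t)`, at the
point `γ(t)`, of the constant vector field with value `V(t)`. -/
def IsParallelAlong (cov : LinearConnection E) (γ V : ℝ → E) : Prop :=
  ∀ t ∈ Set.Icc (0 : ℝ) 1,
    HasDerivWithinAt V
      (-(cov.nabla (fun _ => V t) (γ t) (derivWithin γ (Set.Icc 0 1) t))) (Set.Icc 0 1) t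

/-- `cov.IsTransport x y T`: the linear isomorphism `T : T_x E → T_y E` is the parallel transport
along some piecewise smooth curve from `x` to `y`, i.e. along a finite concatenation of smooth
curves `[0, 1] → E`. -/
inductive IsTransport (cov : LinearConnection E) : E → E → (E ≃ₗ[ℝ] E) → Prop
  | smooth (γ : ℝ → E) (T : E ≃ₗ[ℝ] E) (hγ : ContDiffOn ℝ ∞ γ (Set.Icc 0 1))
      (hT : ∀ v, ∃ V : ℝ → E, cov.IsParallelAlong γ V ∧ V 0 = v ∧ V 1 = T v) :
      IsTransport cov (γ 0) (γ 1) T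
  | concat {x y z : E} {S T : E ≃ₗ[ℝ] E} (hS : IsTransport cov x y S)
      (hT : IsTransport cov y z T) : IsTransport cov x z (S.trans T)

theorem IsTransport.refl (cov : LinearConnection E) (x : E) :
    cov.IsTransport x x (LinearEquiv.refl ℝ E) := by
  refine IsTransport.smooth (cov := cov) (fun _ => x) _ contDiffOn_const fun v => ?_
  refine ⟨fun _ => v, fun t _ => ?_, rfl, rfl⟩
  have h := hasDerivWithinAt_const t (Set.Icc (0 : ℝ) 1) v
  have h0 : derivWithin (fun _ : ℝ => x) (Set.Icc 0 1) t = 0 := by simp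
  rw [h0, map_zero, neg_zero]
  exact h

theorem IsTransport.inv {cov : LinearConnection E} {x y : E} {T : E ≃ₗ[ℝ] E}
    (h : cov.IsTransport x y T) : cov.IsTransport y x T.symm := by
  induction h with
  | concat _ _ hS hT => exact hT.concat hS
  | smooth γ T hγ hT =>
    have hmaps : Set.MapsTo (fun t : ℝ => 1 - t) (Set.Icc 0 1) (Set.Icc 0 1) := by
      intro t ht
      simp only [Set.mem_Icc] at ht ⊢
      constructor <;> linarith [ht.1, ht.2]
    have hrev : ∀ (f : ℝ → E) (f' : E) (t : ℝ),
        HasDerivWithinAt f f' (Set.Icc 0 1) (1 - t) →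
        HasDerivWithinAt (fun s => f (1 - s)) (-f') (Set.Icc 0 1) t := by
      intro f f' t hf
      have h1 : HasDerivWithinAt (fun s : ℝ => 1 - s) (-1) (Set.Icc 0 1) t := by
        simpa using (hasDerivWithinAt_id t (Set.Icc (0 : ℝ) 1)).const_sub 1
      simpa [Function.comp_def] using HasDerivWithinAt.scomp t hf h1 hmaps
    have key := IsTransport.smooth (cov := cov) (fun t => γ (1 - t)) T.symm
      (hγ.comp (by fun_prop) hmaps) (fun v => ?_)
    · simpa using key
    · obtain ⟨V, hV, hV0, hV1⟩ := hT (T.symm v)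
      refine ⟨fun t => V (1 - t), fun t ht => ?_, by simpa using hV1, by simpa using hV0⟩
      have hγ' := hrev γ _ t
        ((hγ.differentiableOn (by simp) (1 - t) (hmaps ht)).hasDerivWithinAt)
      have hd := hγ'.derivWithin (uniqueDiffOn_Icc zero_lt_one t ht)
      have := hrev V _ t (hV (1 - t) (hmaps ht))
      beta_reduce
      rw [hd, map_neg]
      exact this

/-- The holonomy group at `x`: all parallel transports along piecewise smooth loops at `x`. -/
def holonomyGroup (cov : LinearConnection E) (x : E) : Subgroup (E ≃ₗ[ℝ] E) where
  carrier := {T | cov.IsTransport x x T}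
  mul_mem' hS hT := IsTransport.concat hT hS
  one_mem' := IsTransport.refl cov x
  inv_mem' hT := hT.inv

/-- The holonomy group at every point leaves no proper nontrivial subspace invariant. -/
def HasIrreducibleHolonomy (cov : LinearConnection E) : Prop :=
  ∀ x, ∀ W : Submodule ℝ E, (∀ T ∈ cov.holonomyGroup x, ∀ w ∈ W, T w ∈ W) → W = ⊥ ∨ W = ⊤

end LinearConnection

end Holonomy

end

noncomputable section

/-! Torsion is unrestricted, so the problem is algebraic. Take constant metrics `B i` on a real
vector space and let `S` be the space of endomorphisms skew for all of them. Every connection `d +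
A` with all `A(·, u)` in `S` makes the `B i` parallel, so it remains to choose `A` with enough
holonomy and to find forms whose `S` acts irreducibly.

For the holonomy, put `A(v, u) = ℓ₂(u) P(ℓ₁(x)) v` with `P(t) = ∑ t^(k+1) M_k` and `M_k` a basis of
`S`. Rectangular loops in the plane of `e₁, e₂` have transport `exp(s P(ℓ₁ x)) exp(-s P(b))`.
Differentiating at `s = 0`, an invariant subspace is preserved by every `P(ℓ₁ x) - P(b)`, and
comparing coefficients in `b`, by every `M_k` (`exists_smooth_connection_of_endomorphisms`).

The forms are the real and imaginary parts of the complex symmetric form on `ℂ^m`, and the three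
imaginary parts of a quaternionic skew-Hermitian form on `ℍ^r`. A scalar multiplication reverses the
sign of each form, which forces neutral signature. -/

namespace Holonomy

variable {E : Type*} [NormedAddCommGroup E] [NormedSpace ℝ E]

/-! ### Connections `d + A` and transport along segments. -/

namespace LinearConnection

/-- The tangent bundle of a vector space is a product, with smooth projection to the fibre. -/
theorem differentiableAt_of_mdifferentiableAt_section {Y : E → E} {x : E}
    (hY : MDifferentiableAt 𝓘(ℝ, E) (𝓘(ℝ, E).prod 𝓘(ℝ, E))
      (fun y => (⟨y, Y y⟩ : TangentBundle 𝓘(ℝ, E) E)) x) : DifferentiableAt ℝ Y x := by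
  exact (((contMDiff_snd_tangentBundle_modelSpace E 𝓘(ℝ, E) (n := 1)).mdifferentiable
    (by simp)).mdifferentiableAt.comp x hY).differentiableAt

/-- The connection `d + A` for a field `A` of bilinear maps, with `∇_u Y = dY(u) + A(Y, u)`. -/
def ofForm (A : E → E →L[ℝ] E →L[ℝ] E) : LinearConnection E where
  toFun Y x := fderiv ℝ (F := E) Y x + A x (Y x)
  isCovariantDerivativeOnUniv :=
    { add := by
        intro Y Z x hY hZ _
        have hY' := differentiableAt_of_mdifferentiableAt_section hY
        have hZ' := differentiableAt_of_mdifferentiableAt_section hZ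
        have h := fderiv_add hY' hZ'
        have h' : A x (Y x + Z x) = A x (Y x) + A x (Z x) := map_add _ _ _
        refine (congrArg₂ (· + ·) h h').trans ?_
        exact add_add_add_comm _ _ _ _
      leibniz := by
        intro Y f x hY hf _
        have hY' := differentiableAt_of_mdifferentiableAt_section hY
        have hf' : DifferentiableAt ℝ f x := hf.differentiableAt
        have h := fderiv_smul hf' hY'
        have h' : A x (f x • Y x) = f x • A x (Y x) := map_smul _ _ _
        refine (congrArg₂ (· + ·) h h').trans ?_
        have h2 : mvfderiv 𝓘(ℝ, E) f x = fderiv ℝ f x := by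
          ext v
          simp [mvfderiv]
          rfl
        rw [h2]
        ext v
        have key : ∀ (c d : ℝ) (a b y : E), (c • a + d • y) + c • b = c • (a + b) + d • y := by
          intros
          module
        exact key (f x) (fderiv ℝ f x v) (fderiv ℝ (F := E) Y x v) (A x (Y x) v) (Y x) }

theorem nabla_ofForm (A : E → E →L[ℝ] E →L[ℝ] E) (Y : E → E) (x u : E) :
    (ofForm A).nabla Y x u = fderiv ℝ Y x u + A x (Y x) u := rfl

theorem isSmooth_ofForm {A : E → E →L[ℝ] E →L[ℝ] E} (hA : ContDiff ℝ ∞ A) :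
    (ofForm A).IsSmooth := by
  intro Y hY
  exact (hY.fderiv_right (m := ∞) (by simp)).add (hA.clm_apply hY)

/-- The flow of the parallel transport equation along a segment is the parallel transport. -/
theorem isTransport_segment (A : E → E →L[ℝ] E →L[ℝ] E) (x u : E) (T : E ≃ₗ[ℝ] E)
    (hT : ∀ v, ∃ V : ℝ → E, (∀ t, HasDerivAt V (-(A (x + t • u) (V t) u)) t) ∧ V 0 = v ∧
      V 1 = T v) : (ofForm A).IsTransport x (x + u) T := by
  have key := IsTransport.smooth (cov := ofForm A) (fun t => x + t • u) T (by fun_prop)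
    (fun v => ?_)
  · simpa using key
  · obtain ⟨V, hV, h0, h1⟩ := hT v
    refine ⟨V, fun t ht => ?_, h0, h1⟩
    have hd : derivWithin (fun t : ℝ => x + t • u) (Set.Icc 0 1) t = u := by
      have : HasDerivAt (fun t : ℝ => x + t • u) u t := by
        simpa using ((hasDerivAt_id t).smul_const u).const_add x
      exact this.hasDerivWithinAt.derivWithin (uniqueDiffOn_Icc zero_lt_one t ht)
    rw [hd, nabla_ofForm]
    simpa using (hV t).hasDerivWithinAt

end LinearConnection

/-! ### Holonomy of a shear connection around rectangles. -/

variable [CompleteSpace E]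

/-- The exponential of an endomorphism as a linear automorphism. -/
def expEquiv (P : E →L[ℝ] E) : E ≃ₗ[ℝ] E :=
  LinearEquiv.ofLinearMap (NormedSpace.exp P : E →L[ℝ] E).toLinearMap
    (NormedSpace.exp (-P) : E →L[ℝ] E).toLinearMap
    (by
      ext v
      have h : NormedSpace.exp P * NormedSpace.exp (-P) = 1 := by
        let _ : NormedAlgebra ℚ (E →L[ℝ] E) := NormedAlgebra.restrictScalars ℚ ℝ _
        rw [← NormedSpace.exp_add_of_commute (Commute.neg_right (Commute.refl P))]; simp
      exact DFunLike.congr_fun h v)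
    (by
      ext v
      have h : NormedSpace.exp (-P) * NormedSpace.exp P = 1 := by
        let _ : NormedAlgebra ℚ (E →L[ℝ] E) := NormedAlgebra.restrictScalars ℚ ℝ _
        rw [← NormedSpace.exp_add_of_commute (Commute.neg_left (Commute.refl P))]; simp
      exact DFunLike.congr_fun h v)

theorem expEquiv_apply (P : E →L[ℝ] E) (v : E) : expEquiv P v = NormedSpace.exp P v := rfl

theorem hasDerivAt_exp_smul_apply (P : E →L[ℝ] E) (v : E) (t : ℝ) :
    HasDerivAt (fun s : ℝ => NormedSpace.exp (s • P) v) (P (NormedSpace.exp (t • P) v)) t := by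
  have h := hasDerivAt_exp_smul_const' (𝕂 := ℝ) P t
  exact ((ContinuousLinearMap.apply ℝ E v).hasFDerivAt.comp_hasDerivAt t h)

/-- The connection form `A(v, u) = ℓ₂(u) P(ℓ₁(x)) v`. -/
def shearForm (ℓ₁ ℓ₂ : E →L[ℝ] ℝ) (P : ℝ → E →L[ℝ] E) (x : E) : E →L[ℝ] E →L[ℝ] E :=
  (ContinuousLinearMap.smulRightL ℝ E E ℓ₂).comp (P (ℓ₁ x))

omit [CompleteSpace E] in
theorem shearForm_apply (ℓ₁ ℓ₂ : E →L[ℝ] ℝ) (P : ℝ → E →L[ℝ] E) (x v u : E) :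
    shearForm ℓ₁ ℓ₂ P x v u = ℓ₂ u • P (ℓ₁ x) v := rfl

omit [CompleteSpace E] in
theorem contDiff_shearForm (ℓ₁ ℓ₂ : E →L[ℝ] ℝ) {P : ℝ → E →L[ℝ] E} (hP : ContDiff ℝ ∞ P) :
    ContDiff ℝ ∞ (shearForm ℓ₁ ℓ₂ P) :=
  contDiff_const.clm_comp (hP.comp ℓ₁.contDiff)

section Shear

variable {ℓ₁ ℓ₂ : E →L[ℝ] ℝ} {P : ℝ → E →L[ℝ] E} {e₁ e₂ : E}

omit [CompleteSpace E] in
-- The connection form vanishes in direction `e₁`, so constant fields are parallel.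
theorem isTransport_horizontal (h₂₁ : ℓ₂ e₁ = 0) (x : E) (a : ℝ) :
    (LinearConnection.ofForm (shearForm ℓ₁ ℓ₂ P)).IsTransport x (x + a • e₁)
      (LinearEquiv.refl ℝ E) := by
  refine LinearConnection.isTransport_segment _ _ _ _ fun v => ⟨fun _ => v, fun t => ?_, rfl, rfl⟩
  simpa [shearForm_apply, h₂₁] using hasDerivAt_const t v

/-- Since `ℓ₁` is constant along `e₂`, the transport equation has constant coefficients and an
ordinary exponential solves it. -/
theorem isTransport_vertical (h₁₂ : ℓ₁ e₂ = 0) (h₂₂ : ℓ₂ e₂ = 1) (x : E) (s : ℝ) :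
    (LinearConnection.ofForm (shearForm ℓ₁ ℓ₂ P)).IsTransport x (x + s • e₂)
      (expEquiv (-s • P (ℓ₁ x))) := by
  refine LinearConnection.isTransport_segment _ _ _ _ fun v =>
    ⟨fun t => NormedSpace.exp (t • (-s • P (ℓ₁ x))) v, fun t => ?_, by simp, ?_⟩
  · convert hasDerivAt_exp_smul_apply (-s • P (ℓ₁ x)) v t using 1
    simp [shearForm_apply, h₁₂, h₂₂]
  · simp [expEquiv_apply]

theorem exp_trans_exp_mem_holonomyGroup (h₁₁ : ℓ₁ e₁ = 1) (h₂₁ : ℓ₂ e₁ = 0) (h₁₂ : ℓ₁ e₂ = 0)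
    (h₂₂ : ℓ₂ e₂ = 1) (x : E) (b s : ℝ) :
    (expEquiv (-s • P b)).trans (expEquiv (s • P (ℓ₁ x))) ∈
      (LinearConnection.ofForm (shearForm ℓ₁ ℓ₂ P)).holonomyGroup x := by
  -- This width puts the far vertical side of the rectangle on `ℓ₁ = b`.
  set a := b - ℓ₁ x with ha
  have t₁ := isTransport_horizontal (ℓ₁ := ℓ₁) (P := P) h₂₁ x a
  have t₂ := isTransport_vertical (P := P) h₁₂ h₂₂ (x + a • e₁) s
  have t₃ := isTransport_horizontal (ℓ₁ := ℓ₁) (P := P) h₂₁ (x + a • e₁ + s • e₂) (-a)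
  have t₄ := isTransport_vertical (P := P) h₁₂ h₂₂ (x + a • e₁ + s • e₂ + (-a) • e₁) (-s)
  have hx : x + a • e₁ + s • e₂ + (-a) • e₁ + (-s) • e₂ = x := by module
  have h := ((t₁.concat t₂).concat t₃).concat t₄
  rw [hx] at h
  have hb : ℓ₁ (x + a • e₁) = b := by simp [h₁₁, ha]
  have hb' : ℓ₁ (x + a • e₁ + s • e₂ + (-a) • e₁) = ℓ₁ x := by simp [h₁₁, h₁₂]
  rw [hb, hb', neg_neg] at h
  exact h

theorem sub_apply_mem_of_invariant [FiniteDimensional ℝ E] (h₁₁ : ℓ₁ e₁ = 1) (h₂₁ : ℓ₂ e₁ = 0)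
    (h₁₂ : ℓ₁ e₂ = 0) (h₂₂ : ℓ₂ e₂ = 1) {x : E} {W : Submodule ℝ E}
    (hW : ∀ T ∈ (LinearConnection.ofForm (shearForm ℓ₁ ℓ₂ P)).holonomyGroup x, ∀ w ∈ W, T w ∈ W)
    {w : E} (hw : w ∈ W) (b : ℝ) : P (ℓ₁ x) w - P b w ∈ W := by
  -- Testing against functionals that kill `W` turns the claim into differentiating a scalar
  -- function that is identically zero.
  rw [← Subspace.forall_mem_dualAnnihilator_apply_eq_zero_iff]
  intro φ hφ
  rw [Submodule.mem_dualAnnihilator] at hφ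
  have hzero : ∀ s : ℝ, φ (NormedSpace.exp (s • P (ℓ₁ x)) (NormedSpace.exp (s • -P b) w)) = 0 := by
    intro s
    have := hφ _ (hW _ (exp_trans_exp_mem_holonomyGroup h₁₁ h₂₁ h₁₂ h₂₂ x b s) w hw)
    rwa [neg_smul, ← smul_neg] at this
  have hd : HasDerivAt
      (fun s : ℝ => NormedSpace.exp (s • P (ℓ₁ x)) (NormedSpace.exp (s • -P b) w))
      (P (ℓ₁ x) w - P b w) 0 := by
    have h₁ := hasDerivAt_exp_smul_const (𝕂 := ℝ) (P (ℓ₁ x)) 0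
    have h₂ := hasDerivAt_exp_smul_apply (-P b) w 0
    simpa [sub_eq_add_neg] using h₁.clm_apply h₂
  have hφd := (LinearMap.toContinuousLinearMap φ).hasFDerivAt.comp_hasDerivAt 0 hd
  have hc : (LinearMap.toContinuousLinearMap φ ∘ fun s : ℝ =>
      NormedSpace.exp (s • P (ℓ₁ x)) (NormedSpace.exp (s • -P b) w)) = fun _ => 0 :=
    funext hzero
  rw [hc] at hφd
  exact hφd.unique (hasDerivAt_const 0 0)

end Shear

/-! ### From a space of endomorphisms to a connection. -/

/-- The polynomial curve `∑ k, t ^ (k + 1) M_k`. -/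
def powerCurve {V : Type*} [AddCommGroup V] [Module ℝ V] {N : ℕ} (M : Fin N → V) (t : ℝ) : V :=
  ∑ k, t ^ (k.val + 1) • M k

open Polynomial in
-- Exponents start at 1, so no `c k` can be absorbed by the constant `d`.
theorem eq_zero_of_powerCurve_const {N : ℕ} {c : Fin N → ℝ} {d : ℝ}
    (h : ∀ t, powerCurve c t = d) (k : Fin N) : c k = 0 := by
  have hp : ∑ j, C (c j) * X ^ (j.val + 1) = C d := by
    refine Polynomial.funext fun t => ?_
    have := h t
    simp only [powerCurve, smul_eq_mul] at this
    rw [← this]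
    simp [eval_finsetSum, mul_comm (c _)]
  have hk := congrArg (fun p => p.coeff (k.val + 1)) hp
  simpa [finsetSum_coeff, coeff_C_mul, coeff_X_pow, coeff_C, Fin.val_inj] using hk

/-- One polynomial curve through a basis of `S` encodes all of `S`: its coefficients are recovered
from the differences of its values. `S` need not be a Lie algebra. -/
theorem exists_smooth_connection_of_endomorphisms {E : Type*} [NormedAddCommGroup E]
    [NormedSpace ℝ E] [FiniteDimensional ℝ E] {ℓ₁ ℓ₂ : E →L[ℝ] ℝ} {e₁ e₂ : E}
    (h₁₁ : ℓ₁ e₁ = 1) (h₂₁ : ℓ₂ e₁ = 0) (h₁₂ : ℓ₁ e₂ = 0) (h₂₂ : ℓ₂ e₂ = 1)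
    (S : Submodule ℝ (E →L[ℝ] E)) :
    ∃ A : E → E →L[ℝ] E →L[ℝ] E, ContDiff ℝ ∞ A ∧
      (∀ x u, (A x).flip u ∈ S) ∧
      ∀ x (W : Submodule ℝ E),
        (∀ T ∈ (LinearConnection.ofForm A).holonomyGroup x, ∀ w ∈ W, T w ∈ W) →
        ∀ M ∈ S, ∀ w ∈ W, M w ∈ W := by
  have : CompleteSpace E := FiniteDimensional.complete ℝ E
  let b := Module.finBasis ℝ S
  let M : Fin (Module.finrank ℝ S) → E →L[ℝ] E := fun k => b k
  have hM : ∀ t, powerCurve M t ∈ S := fun t =>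
    S.sum_mem fun k _ => S.smul_mem _ (b k).2
  have hsmooth : ContDiff ℝ ∞ (powerCurve M) := by
    unfold powerCurve
    fun_prop
  refine ⟨shearForm ℓ₁ ℓ₂ (powerCurve M), contDiff_shearForm _ _ hsmooth, fun x u => ?_,
    fun x W hW => ?_⟩
  · have : (shearForm ℓ₁ ℓ₂ (powerCurve M) x).flip u = ℓ₂ u • powerCurve M (ℓ₁ x) := by
      ext v; rfl
    rw [this]
    exact S.smul_mem _ (hM _)
  · have key : ∀ k, ∀ w ∈ W, M k w ∈ W := by
      intro k w hw
      rw [← Subspace.forall_mem_dualAnnihilator_apply_eq_zero_iff]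
      intro φ hφ
      have hφ' := (Submodule.mem_dualAnnihilator φ).1 hφ
      refine eq_zero_of_powerCurve_const (c := fun k => φ (M k w))
        (d := φ (powerCurve M (ℓ₁ x) w)) (fun t => ?_) k
      have h := hφ' _ (sub_apply_mem_of_invariant h₁₁ h₂₁ h₁₂ h₂₂ hW hw t)
      rw [map_sub, sub_eq_zero] at h
      rw [h]
      simp [powerCurve]
    intro L hL w hw
    have hsum : L = ∑ k, b.repr ⟨L, hL⟩ k • M k := by
      have := congrArg S.subtype (b.sum_repr ⟨L, hL⟩)
      rw [map_sum] at this
      exact this.symm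
    rw [hsum, _root_.sum_apply]
    exact W.sum_mem fun k _ => W.smul_mem _ (key k w hw)

/-! ### Neutral signature and reduction to linear algebra. -/

/-- Nondegeneracy makes the two indices add up to `2 * m`; the isometry with `-B` makes them equal.
-/
theorem sigPos_sigNeg_of_neg_isometry {V : Type*} [AddCommGroup V] [Module ℝ V]
    [FiniteDimensional ℝ V] {m : ℕ} (hV : Module.finrank ℝ V = 2 * m)
    (B : LinearMap.BilinForm ℝ V) (hs : ∀ v w, B v w = B w v)
    (hB : ∀ v, (∀ w, B v w = 0) → v = 0) (J : V ≃ₗ[ℝ] V)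
    (hJ : ∀ v, B (J v) (J v) = -B v v) :
    sigPos (LinearMap.BilinMap.toQuadraticMap B) = m ∧
      sigNeg (LinearMap.BilinMap.toQuadraticMap B) = m := by
  set Q : QuadraticForm ℝ V := LinearMap.BilinMap.toQuadraticMap B with hQ
  have hrad : Q.radical = ⊥ := by
    rw [QuadraticMap.radical_eq_ker_polarBilin, eq_bot_iff]
    intro v hv
    rw [Submodule.mem_bot]
    refine hB v fun w => ?_
    have h := LinearMap.congr_fun (LinearMap.mem_ker.1 hv) w
    simp [hQ, QuadraticMap.polar, hs w v] at h
    linarith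
  have hsum  := QuadraticForm.sigPos_add_sigNeg_add_radical (Q := Q)
  rw [hrad, finrank_bot, hV] at hsum
  have he : sigPos Q = sigPos (-Q) :=
    QuadraticMap.Equivalent.sigPos_eq ⟨{ J with map_app' := fun v => by simp [hQ, hJ] }⟩
  rw [sigPos_neg] at he
  omega

/-- The endomorphism `L` is skew with respect to every form of the family `B`. -/
def IsSkewFor {V ι : Type*} [AddCommGroup V] [Module ℝ V] (B : ι → LinearMap.BilinForm ℝ V)
    (L : V →ₗ[ℝ] V) : Prop :=
  ∀ i v w, B i (L v) w + B i v (L w) = 0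

/-- A linearly independent family of symmetric nondegenerate forms, each isometric to its negative,
whose common skew endomorphisms act irreducibly. -/
structure IrreducibleNeutralFamily {V ι : Type*} [AddCommGroup V] [Module ℝ V]
    (B : ι → LinearMap.BilinForm ℝ V) : Prop where
  symm : ∀ i v w, B i v w = B i w v
  nondegenerate : ∀ i v, (∀ w, B i v w = 0) → v = 0
  linearIndependent : LinearIndependent ℝ B
  neg_isometry : ∀ i, ∃ J : V ≃ₗ[ℝ] V, ∀ v, B i (J v) (J v) = -B i v v
  irreducible : ∀ W : Submodule ℝ V,
    (∀ L : V →ₗ[ℝ] V, IsSkewFor B L → ∀ w ∈ W, L w ∈ W) → W = ⊥ ∨ W = ⊤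

/-- For constant metrics the derivative terms in `∇g = 0` cancel, leaving exactly skewness of `A(·,
u)`. -/
theorem IrreducibleNeutralFamily.exists_metrics {F ι : Type*} [AddCommGroup F] [Module ℝ F]
    {B : ι → LinearMap.BilinForm ℝ F} (hB : IrreducibleNeutralFamily B)
    [FiniteDimensional ℝ F] {n m : ℕ} (hn : n = 2 * m) (hm : 1 ≤ m)
    (hF : Module.finrank ℝ F = n) :
    ∃ (g : ι → SemiRiemannianMetric (EuclideanSpace ℝ (Fin n)))
      (cov : LinearConnection (EuclideanSpace ℝ (Fin n))),
      SemiRiemannianMetric.Independent g ∧ (∀ i, (g i).HasSignature m m) ∧ cov.IsSmooth ∧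
      (∀ i, (g i).IsParallel cov) ∧ cov.HasIrreducibleHolonomy := by
  let E := EuclideanSpace ℝ (Fin n)
  have hE : Module.finrank ℝ E = n := by simp [E]
  let e : E ≃ₗ[ℝ] F := LinearEquiv.ofFinrankEq E F (hE.trans hF.symm)
  let b : ι → E →L[ℝ] E →L[ℝ] ℝ := fun i =>
    LinearMap.toContinuousLinearMap
      (LinearMap.toContinuousLinearMap.toLinearMap ∘ₗ (B i).compl₁₂ e.toLinearMap e.toLinearMap)
  have hb : ∀ i v w, b i v w = B i (e v) (e w) := fun i v w => rfl
  let g : ι → SemiRiemannianMetric E := fun i =>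
    { form := fun _ => b i
      smooth := contDiff_const
      symm := fun _ v w => hB.symm i _ _
      nondegenerate := fun _ v hv => by
        have := hB.nondegenerate i (e v) fun w => by simpa [hb] using hv (e.symm w)
        simpa using this }
  let S : Submodule ℝ (E →L[ℝ] E) :=
    { carrier := {M | ∀ i v w, b i (M v) w + b i v (M w) = 0}
      zero_mem' := by simp
      add_mem' := by
        intro M N hM hN i v w
        have h1 := hM i v w
        have h2 := hN i v w
        simp only [_root_.add_apply, map_add]
        linarith
      smul_mem' := by
        intro c M hM i v w
        have h1 := hM i v w
        simp only [_root_.smul_apply, map_smul, smul_eq_mul, ← mul_add, h1, mul_zero] }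
  -- The hypothesis `1 ≤ m` supplies the two coordinates that span the rectangles.
  let k₁ : Fin n := ⟨0, by omega⟩
  let k₂ : Fin n := ⟨1, by omega⟩
  have hk : k₁ ≠ k₂ := by simp [k₁, k₂]
  obtain ⟨A, hA, hAS, hirr⟩ := exists_smooth_connection_of_endomorphisms
    (ℓ₁ := EuclideanSpace.proj (𝕜 := ℝ) k₁) (ℓ₂ := EuclideanSpace.proj (𝕜 := ℝ) k₂)
    (e₁ := EuclideanSpace.single k₁ 1) (e₂ := EuclideanSpace.single k₂ 1)
    (by simp) (by simp [hk.symm]) (by simp [hk]) (by simp) S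
  refine ⟨g, LinearConnection.ofForm A, fun x => ?_, fun i x => ?_,
    LinearConnection.isSmooth_ofForm hA, fun i Y Z hY hZ x u => ?_, fun x W hW => ?_⟩
  · rw [linearIndependent_iff'ₛ]
    intro s c d hc i hi
    refine linearIndependent_iff'ₛ.1 hB.linearIndependent s c d ?_ i hi
    ext v w
    have := DFunLike.congr_fun (DFunLike.congr_fun hc (e.symm v)) (e.symm w)
    simpa [g, hb] using this
  · obtain ⟨J, hJ⟩ := hB.neg_isometry i
    refine sigPos_sigNeg_of_neg_isometry (hE.trans hn) (b i).toBilinForm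
      (fun v w => hB.symm i _ _) (fun v => (g i).nondegenerate x v)
      ((e.trans J).trans e.symm) fun v => ?_
    simpa [hb] using hJ (e v)
  · have hY' := (hY.differentiable (by simp) x).hasFDerivAt
    have hZ' := (hZ.differentiable (by simp) x).hasFDerivAt
    have hd := (b i).hasFDerivAt_of_bilinear hY' hZ'
    have hS : b i (A x (Y x) u) (Z x) + b i (Y x) (A x (Z x) u) = 0 := hAS x u i (Y x) (Z x)
    change fderiv ℝ (fun y => b i (Y y) (Z y)) x u = _
    rw [hd.fderiv, LinearConnection.nabla_ofForm, LinearConnection.nabla_ofForm]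
    change b i (Y x) (fderiv ℝ Z x u) + b i (fderiv ℝ Y x u) (Z x) =
      b i (fderiv ℝ Y x u + A x (Y x) u) (Z x) + b i (Y x) (fderiv ℝ Z x u + A x (Z x) u)
    simp only [map_add, _root_.add_apply]
    linarith
  · have hinv := hirr x W hW
    have := hB.irreducible (W.map e.toLinearMap) fun L hL w hw => by
      obtain ⟨v, hv, rfl⟩ := Submodule.mem_map.1 hw
      refine Submodule.mem_map.2 ⟨e.symm (L (e v)), ?_, by simp⟩
      exact hinv (LinearMap.toContinuousLinearMap (e.symm.toLinearMap ∘ₗ L ∘ₗ e.toLinearMap))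
        (fun i v w => by simpa [hb] using hL i (e v) (e w)) v hv
    simpa using this

theorem submodule_eq_top_of_single_mem {K : Type*} [AddCommGroup K] [Module ℝ K] {r : ℕ}
    {W : Submodule ℝ (Fin r → K)} (h : ∀ a z, Pi.single a z ∈ W) : W = ⊤ := by
  refine eq_top_iff.2 fun x _ => ?_
  rw [← Finset.univ_sum_single x]
  exact W.sum_mem fun a _ => h a _

/-! ### Two forms from the complex symmetric form. -/

section Complex

variable {m : ℕ}

/-- The complex bilinear form `∑ x_a y_a`, as a real bilinear map. -/
def complexDot (m : ℕ) : (Fin m → ℂ) →ₗ[ℝ] (Fin m → ℂ) →ₗ[ℝ] ℂ :=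
  LinearMap.mk₂ ℝ (fun x y => ∑ a, x a * y a)
    (fun _ _ _ => by simp [add_mul, Finset.sum_add_distrib])
    (fun _ _ _ => by simp [Finset.mul_sum, mul_assoc])
    (fun _ _ _ => by simp [mul_add, Finset.sum_add_distrib])
    (fun _ _ _ => by simp [Finset.mul_sum, mul_left_comm])

theorem complexDot_apply (x y : Fin m → ℂ) : complexDot m x y = ∑ a, x a * y a := rfl

theorem complexDot_single_right (x : Fin m → ℂ) (a : Fin m) (z : ℂ) :
    complexDot m x (Pi.single a z) = x a * z := by
  simp [complexDot_apply, Pi.single_apply]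

theorem complexDot_comm (x y : Fin m → ℂ) : complexDot m x y = complexDot m y x := by
  simp [complexDot_apply, mul_comm]

/-- The real and imaginary parts of the form `∑ x_a y_a`. -/
def complexForms (m : ℕ) : Fin 2 → LinearMap.BilinForm ℝ (Fin m → ℂ) :=
  ![(complexDot m).compr₂ Complex.reLm, (complexDot m).compr₂ Complex.imLm]

/-- The skew endomorphism `x ↦ c (x_b e_a - x_a e_b)`. -/
def complexRotation (a b : Fin m) (c : ℂ) : (Fin m → ℂ) →ₗ[ℝ] (Fin m → ℂ) where
  toFun x := Pi.single a (c * x b) - Pi.single b (c * x a)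
  map_add' x y := by
    simp only [Pi.add_apply, mul_add, Pi.single_add]
    abel
  map_smul' t x := by
    simp only [Pi.smul_apply, mul_smul_comm, Pi.single_smul, RingHom.id_apply, smul_sub]

theorem complexRotation_apply (a b : Fin m) (c : ℂ) (x : Fin m → ℂ) :
    complexRotation a b c x = Pi.single a (c * x b) - Pi.single b (c * x a) := rfl

theorem isSkewFor_complexRotation (a b : Fin m) (c : ℂ) :
    IsSkewFor (complexForms m) (complexRotation a b c) := by
  intro i v w
  have h : complexDot m (complexRotation a b c v) w + complexDot m v (complexRotation a b c w)
      = 0 := by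
    rw [complexDot_comm _ w, complexRotation_apply, complexRotation_apply, map_sub, map_sub,
      complexDot_single_right, complexDot_single_right, complexDot_single_right,
      complexDot_single_right]
    ring
  fin_cases i
  · simpa [complexForms] using congrArg Complex.re h
  · simpa [complexForms] using congrArg Complex.im h

theorem irreducibleNeutralFamily_complexForms (hm : 3 ≤ m) :
    IrreducibleNeutralFamily (complexForms m) where
  symm i v w := by fin_cases i <;> simp [complexForms, complexDot_comm v w]
  nondegenerate i v h := by
    funext a
    -- This test vector pairs with `v` to `|v_a|² z`.
    have key : ∀ z, complexForms m i v (Pi.single a (star (v a) * z)) = 0 := fun z => h _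
    have hn : Complex.normSq (v a) = 0 := by
      fin_cases i
      · simpa [complexForms, complexDot_single_right, Complex.normSq_apply] using key 1
      · simpa [complexForms, complexDot_single_right, Complex.normSq_apply] using key Complex.I
    exact Complex.normSq_eq_zero.1 hn
  linearIndependent := by
    rw [Fintype.linearIndependent_iffₛ]
    intro c d hc
    let a : Fin m := ⟨0, by omega⟩
    have key : ∀ z : ℂ, ∑ i, c i * complexForms m i (Pi.single a 1) (Pi.single a z) =
        ∑ i, d i * complexForms m i (Pi.single a 1) (Pi.single a z) := by
      intro z
      have := LinearMap.congr_fun (LinearMap.congr_fun hc (Pi.single a 1)) (Pi.single a z)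
      simpa using this
    intro i
    fin_cases i
    · simpa [complexForms, complexDot_single_right] using key 1
    · simpa [complexForms, complexDot_single_right] using key Complex.I
  neg_isometry i := by
    refine ⟨LinearEquiv.ofLinearMap
      (LinearMap.lsmul ℂ (Fin m → ℂ) Complex.I |>.restrictScalars ℝ)
      (LinearMap.lsmul ℂ (Fin m → ℂ) (-Complex.I) |>.restrictScalars ℝ) ?_ ?_, fun v => ?_⟩
    · ext v a; simp [← mul_assoc]
    · ext v a; simp [← mul_assoc]
    · have h : complexDot m (Complex.I • v) (Complex.I • v) = -complexDot m v v := by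
        simp only [complexDot_apply, Pi.smul_apply, smul_eq_mul, ← Finset.sum_neg_distrib]
        refine Finset.sum_congr rfl fun a _ => ?_
        linear_combination (v a * v a) * Complex.I_mul_I
      fin_cases i
      · simpa [complexForms] using congrArg Complex.re h
      · simpa [complexForms] using congrArg Complex.im h
  irreducible W hW := by
    by_cases hbot : W = ⊥
    · exact Or.inl hbot
    right
    obtain ⟨w, hw, hw0⟩ := W.ne_bot_iff.1 hbot
    obtain ⟨a, ha⟩ := Function.ne_iff.1 hw0
    rw [Pi.zero_apply] at ha
    have hrot : ∀ b d c x, x ∈ W → complexRotation b d c x ∈ W := fun b d c x hx =>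
      hW _ (isSkewFor_complexRotation b d c) x hx
    have hd : ∀ d, d ≠ a → ∀ z, Pi.single d z ∈ W := by
      intro d hda z
      -- Here `3 ≤ m` enters: a third index `b` lets two rotations move `w_a` to slot `b` and then
      -- to slot `d`, killing all other coordinates. The factor `-z / w a` makes the result `z e_d`.
      obtain ⟨b, hb⟩ : ∃ b, b ∉ ({a, d} : Finset (Fin m)) := by
        by_contra! hall
        have h1 := Finset.card_le_card (fun x _ => hall x : Finset.univ ⊆ {a, d})
        have h2 := Finset.card_le_two (a := a) (b := d)
        rw [Finset.card_fin] at h1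
        omega
      simp only [Finset.mem_insert, Finset.mem_singleton, not_or] at hb
      have h := hrot d b (-z / w a) _ (hrot a b 1 w hw)
      rw [complexRotation_apply d b, complexRotation_apply a b] at h
      simpa [hb.1, hb.2, hda, Ne.symm hb.1, Pi.single_apply, ha] using h
    refine submodule_eq_top_of_single_mem fun d z => ?_
    by_cases hda : d = a
    · subst hda
      obtain ⟨b, hb⟩ : ∃ b : Fin m, b ≠ d := by
        have : Nontrivial (Fin m) := Fin.nontrivial_iff_two_le.2 (by omega)
        exact exists_ne d
      have h := hrot d b z _ (hd b hb 1)
      simpa [complexRotation_apply, hb] using h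
    · exact hd d hda z

end Complex

/-! ### Three forms from the quaternionic skew-Hermitian form. -/

section Quaternion

variable {r : ℕ}

open Quaternion

/-- The quaternion unit `i`. -/
def unitI : ℍ[ℝ] := ⟨0, 1, 0, 0⟩

@[simp] theorem unitI_re : unitI.re = 0 := rfl

@[simp] theorem unitI_imI : unitI.imI = 1 := rfl

@[simp] theorem unitI_imJ : unitI.imJ = 0 := rfl

@[simp] theorem unitI_imK : unitI.imK = 0 := rfl

/-- The quaternion unit `j`. -/
def unitJ : ℍ[ℝ] := ⟨0, 0, 1, 0⟩

@[simp] theorem unitJ_re : unitJ.re = 0 := rfl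

@[simp] theorem unitJ_imI : unitJ.imI = 0 := rfl

@[simp] theorem unitJ_imJ : unitJ.imJ = 1 := rfl

@[simp] theorem unitJ_imK : unitJ.imK = 0 := rfl

/-- The quaternion unit `k`. -/
def unitK : ℍ[ℝ] := ⟨0, 0, 0, 1⟩

@[simp] theorem unitK_re : unitK.re = 0 := rfl

@[simp] theorem unitK_imI : unitK.imI = 0 := rfl

@[simp] theorem unitK_imJ : unitK.imJ = 0 := rfl

@[simp] theorem unitK_imK : unitK.imK = 1 := rfl

theorem unitI_mul_unitI : unitI * unitI = -1 := by
  ext <;> simp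

theorem unitJ_mul_unitJ : unitJ * unitJ = -1 := by
  ext <;> simp

theorem star_unitI : star unitI = -unitI := by
  ext <;> simp

/-- The skew-Hermitian quaternionic form `∑ x̄_a i y_a`, as a real bilinear map. -/
def quaternionSkew (r : ℕ) : (Fin r → ℍ[ℝ]) →ₗ[ℝ] (Fin r → ℍ[ℝ]) →ₗ[ℝ] ℍ[ℝ] :=
  LinearMap.mk₂ ℝ (fun x y => ∑ a, star (x a) * unitI * y a)
    (fun _ _ _ => by simp [add_mul, Finset.sum_add_distrib])
    (fun _ _ _ => by simp [Finset.smul_sum])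
    (fun _ _ _ => by simp [mul_add, Finset.sum_add_distrib])
    (fun _ _ _ => by simp [Finset.smul_sum])

theorem quaternionSkew_apply (x y : Fin r → ℍ[ℝ]) :
    quaternionSkew r x y = ∑ a, star (x a) * unitI * y a := rfl

theorem quaternionSkew_single_right (x : Fin r → ℍ[ℝ]) (a : Fin r) (z : ℍ[ℝ]) :
    quaternionSkew r x (Pi.single a z) = star (x a) * unitI * z := by
  simp [quaternionSkew_apply, Pi.single_apply]

theorem quaternionSkew_single_left (y : Fin r → ℍ[ℝ]) (a : Fin r) (z : ℍ[ℝ]) :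
    quaternionSkew r (Pi.single a z) y = star z * unitI * y a := by
  rw [quaternionSkew_apply, Finset.sum_eq_single a] <;> simp +contextual

/-- Follows from `star i = -i`; it makes the imaginary parts symmetric, and the real part
alternating. -/
theorem star_quaternionSkew (x y : Fin r → ℍ[ℝ]) :
    star (quaternionSkew r x y) = -quaternionSkew r y x := by
  simp [quaternionSkew_apply, star_unitI, mul_assoc]

/-- The imaginary parts of a quaternion. -/
def imPart : Fin 3 → ℍ[ℝ] →ₗ[ℝ] ℝ :=
  ![QuaternionAlgebra.imIₗ (-1) 0 (-1), QuaternionAlgebra.imJₗ (-1) 0 (-1),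
    QuaternionAlgebra.imKₗ (-1) 0 (-1)]

theorem imPart_zero (q : ℍ[ℝ]) : imPart 0 q = q.imI := rfl

theorem imPart_one (q : ℍ[ℝ]) : imPart 1 q = q.imJ := rfl

theorem imPart_two (q : ℍ[ℝ]) : imPart 2 q = q.imK := rfl

theorem imPart_star (i : Fin 3) (q : ℍ[ℝ]) : imPart i (star q) = -imPart i q := by
  fin_cases i <;> simp [imPart_zero, imPart_one, imPart_two]

/-- The imaginary parts of the form `∑ x̄_a i y_a`. -/
def quaternionForms (r : ℕ) (i : Fin 3) : LinearMap.BilinForm ℝ (Fin r → ℍ[ℝ]) :=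
  (quaternionSkew r).compr₂ (imPart i)

theorem quaternionForms_apply (i : Fin 3) (x y : Fin r → ℍ[ℝ]) :
    quaternionForms r i x y = imPart i (quaternionSkew r x y) := rfl

/-- The endomorphism `x ↦ i q x_a e_b`. -/
def quaternionShift (a b : Fin r) (q : ℍ[ℝ]) : (Fin r → ℍ[ℝ]) →ₗ[ℝ] (Fin r → ℍ[ℝ]) where
  toFun x := Pi.single b (unitI * q * x a)
  map_add' x y := by simp only [Pi.add_apply, mul_add, Pi.single_add]
  map_smul' t x := by
    simp only [Pi.smul_apply, mul_smul_comm, Pi.single_smul, RingHom.id_apply]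

theorem quaternionShift_apply (a b : Fin r) (q : ℍ[ℝ]) (x : Fin r → ℍ[ℝ]) :
    quaternionShift a b q x = Pi.single b (unitI * q * x a) := rfl

theorem quaternionSkew_shift_left (a b : Fin r) (q : ℍ[ℝ]) (x y : Fin r → ℍ[ℝ]) :
    quaternionSkew r (quaternionShift a b q x) y = star (x a) * star q * y b := by
  rw [quaternionShift_apply, quaternionSkew_single_left, star_mul, star_mul, star_unitI,
    mul_assoc (star (x a)), mul_assoc (star q), neg_mul, unitI_mul_unitI, neg_neg, mul_one]

theorem quaternionSkew_shift_right (a b : Fin r) (q : ℍ[ℝ]) (x y : Fin r → ℍ[ℝ]) :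
    quaternionSkew r x (quaternionShift a b q y) = -(star (x b) * q * y a) := by
  rw [quaternionShift_apply, quaternionSkew_single_right]
  calc star (x b) * unitI * (unitI * q * y a) = star (x b) * (unitI * unitI) * q * y a := by
        simp only [mul_assoc]
    _ = _ := by rw [unitI_mul_unitI]; simp

theorem isSkewFor_quaternionShift_add (a b : Fin r) (q : ℍ[ℝ]) :
    IsSkewFor (quaternionForms r) (quaternionShift a b q + quaternionShift b a (star q)) := by
  intro i v w
  rw [quaternionForms_apply, quaternionForms_apply, ← map_add]
  convert map_zero (imPart i) using 2
  simp only [LinearMap.add_apply, map_add, quaternionSkew_shift_left, quaternionSkew_shift_right,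
    star_star]
  abel

theorem isSkewFor_quaternionShift_self (a : Fin r) :
    IsSkewFor (quaternionForms r) (quaternionShift a a 1) := by
  intro i v w
  simp [quaternionForms_apply, quaternionSkew_shift_left, quaternionSkew_shift_right]

/-- Right multiplication by a quaternion of square `-1`. -/
def rightMulEquiv (r : ℕ) (u : ℍ[ℝ]) (hu : u * u = -1) :
    (Fin r → ℍ[ℝ]) ≃ₗ[ℝ] (Fin r → ℍ[ℝ]) where
  toFun x a := x a * u
  invFun x a := -(x a * u)
  left_inv x := by
    funext a
    simp [mul_assoc, hu]
  right_inv x := by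
    funext a
    simp [mul_assoc, hu]
  map_add' x y := by
    funext a
    simp [add_mul]
  map_smul' t x := by
    funext a
    simp

theorem quaternionSkew_rightMulEquiv {u : ℍ[ℝ]} (hu : u * u = -1) (x y : Fin r → ℍ[ℝ]) :
    quaternionSkew r (rightMulEquiv r u hu x) (rightMulEquiv r u hu y) =
      star u * quaternionSkew r x y * u := by
  simp [quaternionSkew_apply, rightMulEquiv, Finset.mul_sum, Finset.sum_mul, mul_assoc]

theorem irreducibleNeutralFamily_quaternionForms (hr : 2 ≤ r) :
    IrreducibleNeutralFamily (quaternionForms r) where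
  symm i v w := by
    rw [quaternionForms_apply, quaternionForms_apply, ← neg_neg (quaternionSkew r v w),
      ← star_quaternionSkew, map_neg, imPart_star, neg_neg]
  nondegenerate i v h := by
    funext a
    have key : ∀ z : ℍ[ℝ], normSq (v a) * imPart i z = 0 := fun z => by
      -- The shift supplies a factor `i` that cancels the one in the form, leaving `-|v_a|² z`.
      have := h (quaternionShift a a 1 (Pi.single a (v a * z)))
      rw [quaternionForms_apply, quaternionSkew_shift_right, mul_one, Pi.single_eq_same,
        ← mul_assoc, Quaternion.star_mul_self, Quaternion.coe_mul_eq_smul, map_neg, map_smul,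
        neg_eq_zero] at this
      exact this
    have hn : normSq (v a) = 0 := by
      fin_cases i
      · simpa [imPart_zero] using key unitI
      · simpa [imPart_one] using key unitJ
      · simpa [imPart_two] using key unitK
    exact normSq_eq_zero.1 hn
  linearIndependent := by
    rw [Fintype.linearIndependent_iffₛ]
    intro c d hc
    let a : Fin r := ⟨0, by omega⟩
    have key : ∀ z : ℍ[ℝ], ∑ i, c i * imPart i (unitI * z) =
        ∑ i, d i * imPart i (unitI * z) := by
      intro z
      have := LinearMap.congr_fun (LinearMap.congr_fun hc (Pi.single a 1)) (Pi.single a z)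
      simpa [quaternionForms_apply, quaternionSkew_single_right] using this
    simp only [Fin.sum_univ_three, imPart_zero, imPart_one, imPart_two] at key
    intro i
    fin_cases i
    -- Left multiplication by `i` sends `1, k, j` to `i, -j, k`, isolating one coefficient each.
    · simpa using key 1
    · simpa using key unitK
    · simpa using key unitJ
  neg_isometry i := by
    -- Conjugation by a unit negates the imaginary units anticommuting with it.
    have hI : ∀ q : ℍ[ℝ], imPart 0 (star unitJ * q * unitJ) = -imPart 0 q := fun q => by
      simp [imPart_zero]
    have hJ : ∀ q : ℍ[ℝ], imPart 1 (star unitI * q * unitI) = -imPart 1 q := fun q => by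
      simp [imPart_one]
    have hK : ∀ q : ℍ[ℝ], imPart 2 (star unitI * q * unitI) = -imPart 2 q := fun q => by
      simp [imPart_two]
    fin_cases i
    · exact ⟨rightMulEquiv r unitJ unitJ_mul_unitJ, fun v => by
        simp [quaternionForms_apply, quaternionSkew_rightMulEquiv, hI]⟩
    · exact ⟨rightMulEquiv r unitI unitI_mul_unitI, fun v => by
        simp [quaternionForms_apply, quaternionSkew_rightMulEquiv, hJ]⟩
    · exact ⟨rightMulEquiv r unitI unitI_mul_unitI, fun v => by
        simp [quaternionForms_apply, quaternionSkew_rightMulEquiv, hK]⟩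
  irreducible W hW := by
    by_cases hbot : W = ⊥
    · exact Or.inl hbot
    right
    obtain ⟨w, hw, hw0⟩ := W.ne_bot_iff.1 hbot
    obtain ⟨a, ha⟩ := Function.ne_iff.1 hw0
    rw [Pi.zero_apply] at ha
    have hI0 : unitI ≠ 0 := fun h => by
      have := unitI_mul_unitI
      simp [h] at this
    have hspread : ∀ a p, p ≠ 0 → Pi.single a p ∈ W → ∀ b, b ≠ a → ∀ z, Pi.single b z ∈ W := by
      intro a p hp hmem b hba z
      -- The parameter solves `i q p = z`; the reverse shift contributes nothing because slot `b` is
      -- empty.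
      have h := hW _ (isSkewFor_quaternionShift_add a b (unitI⁻¹ * z * p⁻¹)) _ hmem
      simpa [quaternionShift_apply, hba, mul_assoc, hp, hI0] using h
    -- The diagonal shift isolates the coordinate `w a`, so `2 ≤ r` suffices: a second slot is
    -- needed only to return to `a` with an arbitrary value.
    have hself : Pi.single a (unitI * w a) ∈ W := by
      simpa [quaternionShift_apply] using hW _ (isSkewFor_quaternionShift_self a) w hw
    have hother := hspread a _ (mul_ne_zero hI0 ha) hself
    refine submodule_eq_top_of_single_mem fun d z => ?_
    by_cases hda : d = a
    · subst hda
      obtain ⟨b, hb⟩ : ∃ b : Fin r, b ≠ d := by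
        have : Nontrivial (Fin r) := Fin.nontrivial_iff_two_le.2 hr
        exact exists_ne d
      exact hspread b 1 one_ne_zero (hother b hb 1) d hb.symm z
    · exact hother d hda z

end Quaternion

end Holonomy
end
theorem theorem2 :
    (∀ n m : ℕ, n = 2 * m → 3 ≤ m →
      ∃ (g : Fin 2 → Holonomy.SemiRiemannianMetric (EuclideanSpace ℝ (Fin n)))
        (cov : Holonomy.LinearConnection (EuclideanSpace ℝ (Fin n))),
        Holonomy.SemiRiemannianMetric.Independent g ∧
        (∀ i, (g i).HasSignature m m) ∧
        cov.IsSmooth ∧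
        (∀ i, (g i).IsParallel cov) ∧
        cov.HasIrreducibleHolonomy) ∧
    (∀ n m r : ℕ, n = 2 * m → m = 2 * r → 2 ≤ r →
      ∃ (g : Fin 3 → Holonomy.SemiRiemannianMetric (EuclideanSpace ℝ (Fin n)))
        (cov : Holonomy.LinearConnection (EuclideanSpace ℝ (Fin n))),
        Holonomy.SemiRiemannianMetric.Independent g ∧
        (∀ i, (g i).HasSignature m m) ∧
        cov.IsSmooth ∧
        (∀ i, (g i).IsParallel cov) ∧
        cov.HasIrreducibleHolonomy) := by
  refine ⟨fun n m hn hm => ?_, fun n m r hn hm hr => ?_⟩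
  · exact (Holonomy.irreducibleNeutralFamily_complexForms hm).exists_metrics hn (by omega)
      (by simp [Module.finrank_pi_fintype, Complex.finrank_real_complex]; omega)
  · exact (Holonomy.irreducibleNeutralFamily_quaternionForms hr).exists_metrics hn (by omega)
      (by simp [Module.finrank_pi_fintype, Quaternion.finrank_eq_four]; omega)
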